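/- For $k\in\mathbb N$, a $k$-marked group is a group $G$ together with a $k$-tuple $S$ of elements generating $G$, considered up to isomorphisms of groups that match the tuples; it is identified with its set of relations, a normal subgroup of the free group $\mathbb F_k$ of rank $k$. The space of $k$-marked groups carries the topology induced from the Cantor space $\{0,1\}^{\mathbb F_k}$ (product of discrete spaces) by the characteristic functions of the sets of relations, and the space of marked groups $\mathcal G$ is the topological disjoint union of these spaces over all $k\in\mathbb N$. For a class $\mathcal C$ of groups, a group $G$ is residually-$\mathcal C$ if for every $g\in G$, $g\neq 1$, there is a quotient of $G$ that belongs to $\mathcal C$ and in which the image of $g$ is non-trivial. In a topological space, the $\boldsymbol\Sigma^0_1$ sets are the open sets, the $\boldsymbol\Pi^0_n$ sets are the complements of the $\boldsymbol\Sigma^0_n$ sets, and for $n>1$ the $\boldsymbol\Sigma^0_n$ sets are the countable unions of sets each of which is $\boldsymbol\Pi^0_m$ for some $1\le m<n$. A subset $A$ of $\mathcal G$ is $\boldsymbol\Pi^0_3$-complete if it is $\boldsymbol\Pi^0_3$ in $\mathcal G$ and for every zero-dimensional Polish space $X$ and every $\boldsymbol\Pi^0_3$ subset $B$ of $X$ there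 is a continuous map $f\colon X\to\mathcal G$ with $f^{-1}(A)=B$. Theorem G. In the space of marked groups $\mathcal G$, the set of residually finite marked groups is $\boldsymbol\Pi^0_3$-complete. So is the set of residually nilpotent marked groups, and so is the set of residually finitely presented marked groups. -/

import Mathlib

universe u v

section BorelHierarchy

/-- The finite additive levels `Σ⁰ₙ`, `n ≥ 1`, of the Borel hierarchy of a topological space:
`Σ⁰₁` sets are the open sets, and for `n > 1` a set is `Σ⁰ₙ` if it is a countable union of
complements of sets `f i`, where each `f i` is `Σ⁰_{m i}` for some `m i < n`.
(No set is `Σ⁰₀`.) -/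
inductive IsSigmaZero {X : Type u} [TopologicalSpace X] : ℕ → Set X → Prop
  | of_isOpen {s : Set X} (hs : IsOpen s) : IsSigmaZero 1 s
  | iUnion_compl {n : ℕ} (hn : 1 < n) (m : ℕ → ℕ) (hm : ∀ i, m i < n) (f : ℕ → Set X)
      (hf : ∀ i, IsSigmaZero (m i) (f i)) : IsSigmaZero n (⋃ i, (f i)ᶜ)

/-- The finite multiplicative levels `Π⁰ₙ` of the Borel hierarchy: complements of `Σ⁰ₙ` sets. -/
def IsPiZero {X : Type u} [TopologicalSpace X] (n : ℕ) (s : Set X) : Prop :=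
  IsSigmaZero n sᶜ

/-- Wadge reducibility: `B` is the preimage of `A` under a continuous map. -/
def WadgeReducible {X : Type u} {Y : Type v} [TopologicalSpace X] [TopologicalSpace Y]
    (B : Set X) (A : Set Y) : Prop :=
  ∃ f : X → Y, Continuous f ∧ f ⁻¹' A = B

/-- A subset `A` of a topological space is `Π⁰ₙ`-complete if it is `Π⁰ₙ` and every `Π⁰ₙ` subset of
every zero-dimensional (i.e. the clopen sets form a basis) Polish space is Wadge reducible
to `A`. -/
def IsPiZeroComplete {Y : Type v} [TopologicalSpace Y] (n : ℕ) (A : Set Y) : Prop :=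
  IsPiZero n A ∧
    ∀ (X : Type u) [TopologicalSpace X] [PolishSpace X],
      TopologicalSpace.IsTopologicalBasis {U : Set X | IsClopen U} →
        ∀ B : Set X, IsPiZero n B → WadgeReducible B A

end BorelHierarchy

section MarkedGroups

/-- A `k`-marked group, up to isomorphism of marked groups: the pair `(G, (s₁, …, s_k))` is given
by its set of relations, the kernel of the epimorphism from the free group of rank `k` onto `G`
that maps the basis to `(s₁, …, s_k)`. -/
structure KMarkedGroup (k : ℕ) where
  /-- the set of relations -/
  relations : Subgroup (FreeGroup (Fin k))
  normal : relations.Normal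

attribute [instance] KMarkedGroup.normal

/-- The underlying group of a `k`-marked group. -/
abbrev KMarkedGroup.Carrier {k : ℕ} (M : KMarkedGroup k) : Type :=
  FreeGroup (Fin k) ⧸ M.relations

open Classical in
/-- The characteristic function of the set of relations, a point of a Cantor space (the product
topology of the discrete space `Bool`). -/
noncomputable def KMarkedGroup.wordProblem {k : ℕ} (M : KMarkedGroup k) :
    FreeGroup (Fin k) → Bool :=
  fun w => decide (w ∈ M.relations)

/-- The space of `k`-marked groups is a subspace of the Cantor space. -/
noncomputable instance (k : ℕ) : TopologicalSpace (KMarkedGroup k) :=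
  TopologicalSpace.induced KMarkedGroup.wordProblem Pi.topologicalSpace

/-- The space of marked groups: the topological disjoint union, over all `k`, of the spaces of
`k`-marked groups. -/
abbrev MarkedGroup : Type := Σ k : ℕ, KMarkedGroup k

/-- The underlying group of a marked group. -/
abbrev MarkedGroup.Carrier (M : MarkedGroup) : Type := M.2.Carrier

/-- A group `G` is residually-`C` if every non-identity element of `G` has a non-identity image in
some quotient of `G` that belongs to `C`. -/
def IsResidually (C : ∀ (H : Type u) [Group H], Prop) (G : Type u) [Group G] : Prop :=
  ∀ g : G, g ≠ 1 → ∃ (N : Subgroup G) (_ : N.Normal), C (G ⧸ N) ∧ (g : G ⧸ N) ≠ 1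

/-- For `C` the class of finite groups this is Mathlib's notion of a residually finite group. -/
theorem isResidually_finite_iff (G : Type u) [Group G] :
    IsResidually (fun H _ => Finite H) G ↔ Group.ResiduallyFinite G := by
  rw [Group.residuallyFinite_iff_exists_finiteIndexNormalSubgroup]
  refine forall_congr' fun g => imp_congr_right fun _ => ⟨?_, ?_⟩
  · rintro ⟨N, hN, hfin, hg⟩
    have hfi : N.FiniteIndex := Subgroup.finiteIndex_of_finite_quotient
    exact ⟨.ofSubgroup N, fun h => hg ((QuotientGroup.eq_one_iff g).2 h)⟩
  · rintro ⟨N, hg⟩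
    exact ⟨N.toSubgroup, inferInstance, inferInstance,
      fun h => hg ((QuotientGroup.eq_one_iff g).1 h)⟩

/-- The set of residually-`C` marked groups. -/
def residuallySet (C : ∀ (H : Type) [Group H], Prop) : Set MarkedGroup :=
  {M | IsResidually C M.Carrier}

end MarkedGroups

/-!
The upper bounds are counts of quantifiers. A marked group is residually-`C` if and only if every
word outside its relations survives in some quotient in `C` of the free group that satisfies the
relations (`isResidually_quotient_iff`). A free group of finite rank has only countably many
finitely presented quotients, and for a fixed normal subgroup `N` the condition `R ≤ N` on the
relations `R` is closed. For nilpotent quotients the survival of `w` means `w ∉ R ⊔ γₙ` for some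
term `γₙ` of the lower central series, again a closed condition for each `n`.

For the lower bounds, one continuous map serves all three classes. In a zero-dimensional Polish space
a `Π⁰₃` set is of the form `{x | ∀ i, S i x is finite}` with clopen conditions `n ∈ S i x`
(`IsPiZero.exists_finite_iff`). Consider the group generated by `t` and `u` in which the conjugates
`uₙ` of `u` by `t ^ n` generate a subgroup of class two and the commutators `aₙ = [u₀, uₙ]` are
central; it is a central extension of the lamplighter group, realised here as a group of triples over
the Laurent polynomials over the field with two elements (`HallGroup`, after P. Hall). Any
identification of the `aₙ` with each other gives a quotient by a central subgroup, and whether a word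
is a relation of that quotient depends on finitely many of the identifications only. Choose
positions `q` converging to `0` in the profinite topology of `ℤ`, indexed by pairs `(i, l)`, and
identify the commutators at `(i, l + 1)` and `(i, 0)` if `l ∈ S i x`.

If all `S i x` are finite, the group is residually a finite `2`-group
(`exists_finite_two_group_of_finite_fibers`). Indeed, the word is either nontrivial in the
lamplighter group, or central, and then detected by the indicator function of a finite class of
identified indices; positions being either small or zero modulo suitable powers of `2`, that function
can be made periodic, and a periodic function on the indices extends to a finite quotient.

If `S i x` is infinite, then the commutator at `(i, 0)`, which is not trivial, dies in every
quotient that is finite, nilpotent or finitely presented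
(`comm_mem_of_isNilpotent_or_isFinitelyPresented`). If some nonzero Laurent polynomial dies in the
quotient, then so does some `T ^ m - 1`, so that `aₙ` is periodic in `n` with period `m`; as `m`
divides infinitely many of the identified indices, the common value is `a₀ = 1`. This covers nilpotent
quotients, where a power of `T - 1` dies. Otherwise the quotient is by a central subgroup, and it is
not finitely presented, as finitely many relators involve only finitely many of the `aₙ`, while
infinitely many of them are identified.
-/

/-! ### Low levels of the Borel hierarchy -/

theorem IsSigmaZero.exists_isClosed_of_lt_three {X : Type*} [TopologicalSpace X]
    [SecondCountableTopology X] (hX : TopologicalSpace.IsTopologicalBasis {U : Set X | IsClopen U})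
    {n : ℕ} (hn : n < 3) {s : Set X} (hs : IsSigmaZero n s) :
    ∃ F : ℕ → Set X, (∀ j, IsClosed (F j)) ∧ s = ⋃ j, F j := by
  have isOpen_of_lt_two : ∀ {m : ℕ} {t : Set X}, m < 2 → IsSigmaZero m t → IsOpen t := by
    intro m t hm ht
    cases ht with
    | of_isOpen h => exact h
    | iUnion_compl h => omega
  cases hs with
  | of_isOpen h =>
    obtain ⟨S, hS, rfl⟩ := hX.open_eq_sUnion h
    obtain ⟨T, hTc, hTS, hT⟩ :=
      TopologicalSpace.isOpen_sUnion_countable S fun U hU => (hS hU).isOpen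
    rcases T.eq_empty_or_nonempty with rfl | hne
    · exact ⟨fun _ => ∅, fun _ => isClosed_empty, by simp [← hT]⟩
    · obtain ⟨f, rfl⟩ := hTc.exists_eq_range hne
      exact ⟨f, fun j => (hS (hTS ⟨j, rfl⟩)).isClosed, by simp [← hT]⟩
  | iUnion_compl _ m hm f hf =>
    exact ⟨fun j => (f j)ᶜ, fun j =>
      (isOpen_of_lt_two (by have := hm j; omega) (hf j)).isClosed_compl, rfl⟩

theorem IsClosed.exists_isClopen_iInter {X : Type*} [TopologicalSpace X]
    [SecondCountableTopology X] (hX : TopologicalSpace.IsTopologicalBasis {U : Set X | IsClopen U})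
    {s : Set X} (hs : IsClosed s) :
    ∃ U : ℕ → Set X, (∀ l, IsClopen (U l)) ∧ s = ⋂ l, U l := by
  obtain ⟨S, hS, hSs⟩ := hX.open_eq_sUnion hs.isOpen_compl
  obtain ⟨T, hTc, hTS, hT⟩ :=
    TopologicalSpace.isOpen_sUnion_countable S fun U hU => (hS hU).isOpen
  rw [← hT] at hSs
  rcases T.eq_empty_or_nonempty with rfl | hne
  · exact ⟨fun _ => Set.univ, fun _ => isClopen_univ, by simpa using hSs⟩
  · obtain ⟨f, rfl⟩ := hTc.exists_eq_range hne
    refine ⟨fun j => (f j)ᶜ, fun j => (hS (hTS ⟨j, rfl⟩)).compl, ?_⟩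
    rw [← compl_compl s, hSs]
    simp

/-- In a zero-dimensional second countable space, a `Π⁰₃` set is the set of points at which
countably many sets of naturals are all finite, where each membership is a clopen condition. The
`i`-th set, for the `i`-th `Σ⁰₂` set `⋃ j, F j` with closed `F j = ⋂ l, U j l` increasing in `j` and
clopen `U j l`, consists of the codes of the pairs `(j, l)` for which `U j l` is the first of
`U j 0, U j 1, …` to be left. -/
theorem IsPiZero.exists_finite_iff {X : Type*} [TopologicalSpace X]
    [SecondCountableTopology X] (hX : TopologicalSpace.IsTopologicalBasis {U : Set X | IsClopen U})
    {B : Set X} (hB : IsPiZero 3 B) :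
    ∃ S : ℕ → X → Set ℕ, (∀ i n, IsClopen {x | n ∈ S i x}) ∧
      ∀ x, x ∈ B ↔ ∀ i, (S i x).Finite := by
  obtain ⟨m, hm, f, hf, hBf⟩ : ∃ m : ℕ → ℕ, (∀ i, m i < 3) ∧ ∃ f : ℕ → Set X,
      (∀ i, IsSigmaZero (m i) (f i)) ∧ Bᶜ = ⋃ i, (f i)ᶜ := by
    unfold IsPiZero at hB
    generalize hC : Bᶜ = C at hB
    cases hB with
    | iUnion_compl _ m hm f hf => exact ⟨m, hm, f, hf, rfl⟩
  have key : ∀ i, ∃ S : X → Set ℕ, (∀ n, IsClopen {x | n ∈ S x}) ∧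
      ∀ x, x ∈ f i ↔ (S x).Finite := by
    intro i
    obtain ⟨F, hF, hfF⟩ := (hf i).exists_isClosed_of_lt_three hX (hm i)
    have hacc : ∀ j, IsClosed (Set.accumulate F j) := fun j => by
      rw [Set.accumulate_def]
      exact (Set.finite_Iic j).isClosed_biUnion fun k _ => hF k
    choose U hU hFU using fun j => (hacc j).exists_isClopen_iInter hX
    refine ⟨fun x => {n | x ∉ U n.unpair.1 n.unpair.2 ∧
      ∀ l < n.unpair.2, x ∈ U n.unpair.1 l}, fun n => ?_, fun x => ?_⟩
    · have : {x | x ∉ U n.unpair.1 n.unpair.2 ∧ ∀ l < n.unpair.2, x ∈ U n.unpair.1 l} =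
          (U n.unpair.1 n.unpair.2)ᶜ ∩ ⋂ l ∈ Set.Iio n.unpair.2, U n.unpair.1 l := by
        ext x; simp
      exact this ▸ (hU _ _).compl.inter ((Set.finite_Iio _).isClopen_biInter fun l _ => hU _ l)
    · have hfx : x ∈ f i ↔ ∃ j, x ∈ Set.accumulate F j := by
        rw [hfF, ← Set.iUnion_accumulate, Set.mem_iUnion]
      rw [hfx]
      constructor
      · rintro ⟨j, hj⟩
        -- only indices `j' < j` contribute, each at most one code
        refine Set.Finite.of_finite_image (f := fun n => n.unpair.1)
          ((Set.finite_Iio j).subset ?_) ?_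
        · rintro _ ⟨n, hn, rfl⟩
          by_contra hjn
          have := Set.monotone_accumulate (s := F) (not_lt.1 hjn) hj
          rw [hFU, Set.mem_iInter] at this
          exact hn.1 (this _)
        · intro n hn n' hn' h
          have h : n.unpair.1 = n'.unpair.1 := h
          have h2 : n.unpair.2 = n'.unpair.2 := by
            rcases lt_trichotomy n.unpair.2 n'.unpair.2 with hlt | heq | hlt
            · exact absurd (h ▸ hn'.2 _ hlt) hn.1
            · exact heq
            · exact absurd (h ▸ hn.2 _ hlt) hn'.1
          rw [← Nat.pair_unpair n, ← Nat.pair_unpair n', h, h2]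
      · intro hfin
        by_contra! hx
        have hex : ∀ j, ∃ l, x ∉ U j l := fun j => by
          have := hx j
          rwa [hFU, Set.mem_iInter, not_forall] at this
        classical
        refine Set.infinite_of_injective_forall_mem
          (f := fun j => Nat.pair j (Nat.find (hex j))) ?_ (fun j => ?_) hfin
        · intro j j' h
          exact (Nat.pair_eq_pair.1 h).1
        · simp only [Set.mem_ofPred_eq, Nat.unpair_pair]
          exact ⟨Nat.find_spec (hex j), fun l hl => not_not.1 (Nat.find_min (hex j) hl)⟩
  choose S hS hfS using key
  refine ⟨S, hS, fun x => ?_⟩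
  have : B = ⋂ i, f i := by rw [← compl_compl B, hBf]; simp
  simp only [this, Set.mem_iInter, hfS]

theorem isPiZero_three_iInter_iUnion {X ι : Type*} [TopologicalSpace X] [Countable ι] [Nonempty ι]
    (F : ι → ℕ → Set X) (hF : ∀ i j, IsClosed (F i j)) : IsPiZero 3 (⋂ i, ⋃ j, F i j) := by
  obtain ⟨e, he⟩ := exists_surjective_nat ι
  have h2 : ∀ i, IsSigmaZero 2 (⋃ j, F i j) := fun i => by
    simpa using IsSigmaZero.iUnion_compl (X := X) one_lt_two (fun _ => 1) (fun _ => one_lt_two)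
      (fun j => (F i j)ᶜ) fun j => .of_isOpen (hF i j).isOpen_compl
  have h3 := IsSigmaZero.iUnion_compl (n := 3) (by norm_num) (fun _ => 2) (fun _ => by norm_num)
    _ fun i => h2 (e i)
  rw [IsPiZero, Set.compl_iInter]
  rwa [he.iUnion_comp fun i => (⋃ j, F i j)ᶜ] at h3

/-! ### Residual properties and relations -/

/-- A word outside the relations has to survive in a quotient in `C` of the free group that
satisfies the relations. -/
theorem isResidually_quotient_iff {C : ∀ (H : Type u) [Group H], Prop}
    (hC : ∀ (H K : Type u) [Group H] [Group K], H ≃* K → C H → C K)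
    {F : Type u} [Group F] (R : Subgroup F) [R.Normal] :
    IsResidually C (F ⧸ R) ↔ ∀ w ∉ R, ∃ (N : Subgroup F) (_ : N.Normal),
      R ≤ N ∧ C (F ⧸ N) ∧ w ∉ N := by
  constructor
  · intro h w hw
    obtain ⟨N, hN, hCN, hwN⟩ := h (w : F ⧸ R) (by rwa [Ne, QuotientGroup.eq_one_iff])
    have hle : R ≤ N.comap (QuotientGroup.mk' R) := fun r hr => by
      simp [(QuotientGroup.eq_one_iff r).2 hr, N.one_mem]
    refine ⟨N.comap (QuotientGroup.mk' R), inferInstance, hle,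
      hC _ _ (QuotientGroup.quotientQuotientEquivQuotient R _ hle) ?_, ?_⟩
    · have hmap : (N.comap (QuotientGroup.mk' R)).map (QuotientGroup.mk' R) = N :=
        Subgroup.map_comap_eq_self_of_surjective (QuotientGroup.mk'_surjective R) N
      exact hC _ _ (QuotientGroup.quotientMulEquivOfEq hmap.symm) hCN
    · rwa [Ne, QuotientGroup.eq_one_iff] at hwN
  · intro h g hg
    obtain ⟨w, rfl⟩ := QuotientGroup.mk_surjective g
    obtain ⟨N, hN, hRN, hCN, hwN⟩ := h w (by rwa [Ne, QuotientGroup.eq_one_iff] at hg)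
    refine ⟨N.map (QuotientGroup.mk' R), inferInstance,
      hC _ _ (QuotientGroup.quotientQuotientEquivQuotient R N hRN).symm hCN, ?_⟩
    rw [Ne, QuotientGroup.eq_one_iff]
    rintro ⟨n, hn, hnw⟩
    have : n⁻¹ * w ∈ R := QuotientGroup.eq.1 hnw
    exact hwN (by simpa using N.mul_mem hn (hRN this))

/-- Finite presentability does not depend on the finite generating tuple. -/
theorem Group.IsFinitelyPresented.isFinitelyNormallyGenerated_of_quotient {k : ℕ}
    (N : Subgroup (FreeGroup (Fin k))) [N.Normal]
    (h : Group.IsFinitelyPresented (FreeGroup (Fin k) ⧸ N)) : N.IsFinitelyNormallyGenerated := by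
  obtain ⟨n, φ, hφ, S, hS, hSφ⟩ := h.out
  choose a ha using fun i => hφ (QuotientGroup.mk (FreeGroup.of i))
  choose b hb using fun j => QuotientGroup.mk'_surjective N (φ (FreeGroup.of j))
  have hα : φ.comp (FreeGroup.lift a) = QuotientGroup.mk' N := FreeGroup.ext_hom _ _ (by simpa)
  have hβ : (QuotientGroup.mk' N).comp (FreeGroup.lift b) = φ := FreeGroup.ext_hom _ _ (by simpa)
  set α := FreeGroup.lift a
  set β := FreeGroup.lift b
  -- the images of the given relators, and the words that rewrite each generator
  set T : Set (FreeGroup (Fin k)) :=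
    β '' S ∪ Set.range fun i => (FreeGroup.of i)⁻¹ * β (α (FreeGroup.of i)) with hT
  refine ⟨T, (hS.image _).union (Set.finite_range _), le_antisymm ?_ fun w hw => ?_⟩
  · refine Subgroup.normalClosure_le_normal (Set.union_subset ?_ ?_)
    · rintro _ ⟨s, hs, rfl⟩
      have h1 : φ s = 1 := by
        have : s ∈ φ.ker := hSφ ▸ Subgroup.subset_normalClosure hs
        exact this
      rw [← hβ] at h1
      exact (QuotientGroup.eq_one_iff _).1 h1
    · rintro _ ⟨i, rfl⟩
      refine QuotientGroup.eq.1 ?_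
      have h1 := DFunLike.congr_fun hβ (α (FreeGroup.of i))
      have h2 := DFunLike.congr_fun hα (FreeGroup.of i)
      exact (h1.trans h2).symm
  · have hid : (QuotientGroup.mk' (Subgroup.normalClosure T)).comp (β.comp α) =
        QuotientGroup.mk' (Subgroup.normalClosure T) := by
      refine FreeGroup.ext_hom _ _ fun i => (QuotientGroup.eq.2 ?_).symm
      exact Subgroup.subset_normalClosure (Or.inr ⟨i, rfl⟩)
    have hαw : α w ∈ Subgroup.normalClosure S := by
      rw [hSφ, MonoidHom.mem_ker, ← MonoidHom.comp_apply, hα]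
      exact (QuotientGroup.eq_one_iff w).2 hw
    have hβα : β (α w) ∈ Subgroup.normalClosure T := by
      have : Subgroup.normalClosure S ≤ (Subgroup.normalClosure T).comap β :=
        Subgroup.normalClosure_le_normal fun s hs =>
          Subgroup.subset_normalClosure (Or.inl ⟨s, hs, rfl⟩)
      exact this hαw
    have := DFunLike.congr_fun hid w
    exact (QuotientGroup.eq_one_iff w).1 (this.symm.trans ((QuotientGroup.eq_one_iff _).2 hβα))

theorem isNilpotent_quotient_iff_lowerCentralSeries_le {F : Type*} [Group F] (N : Subgroup F)
    [N.Normal] :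
    Group.IsNilpotent (F ⧸ N) ↔ ∃ n, (⊤ : Subgroup F).lowerCentralSeries n ≤ N := by
  have hmap : ∀ n, ((⊤ : Subgroup F).lowerCentralSeries n).map (QuotientGroup.mk' N) =
      (⊤ : Subgroup (F ⧸ N)).lowerCentralSeries n := fun n => by
    rw [Subgroup.map_lowerCentralSeries,
      Subgroup.map_top_of_surjective _ (QuotientGroup.mk'_surjective N)]
  rw [Subgroup.nilpotent_iff_lowerCentralSeries]
  simp only [← hmap, Subgroup.map_eq_bot_iff, QuotientGroup.ker_mk']

/-! ### The residual sets are `Π⁰₃` -/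

namespace KMarkedGroup

theorem isClopen_setOf_mem {k : ℕ} (w : FreeGroup (Fin k)) :
    IsClopen {M : KMarkedGroup k | w ∈ M.relations} := by
  have : {M : KMarkedGroup k | w ∈ M.relations} =
      wordProblem ⁻¹' ((fun f => f w) ⁻¹' {true}) := by
    ext M; simp [wordProblem]
  rw [this]
  exact ((isClopen_discrete {true}).preimage (continuous_apply w)).preimage continuous_induced_dom

theorem isClosed_setOf_le {k : ℕ} (N : Subgroup (FreeGroup (Fin k))) :
    IsClosed {M : KMarkedGroup k | M.relations ≤ N} := by
  have : {M : KMarkedGroup k | M.relations ≤ N} = ⋂ w ∈ (N : Set (FreeGroup (Fin k)))ᶜ,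
      {M : KMarkedGroup k | w ∈ M.relations}ᶜ := by
    ext M
    simp only [Set.mem_ofPred_eq, Set.mem_iInter, Set.mem_compl_iff, SetLike.mem_coe]
    exact forall_congr' fun w => not_imp_not.symm
  rw [this]
  exact isClosed_biInter fun w _ => (isClopen_setOf_mem w).compl.isClosed

theorem isClosed_setOf_notMem_sup {k : ℕ} (w : FreeGroup (Fin k))
    (N : Subgroup (FreeGroup (Fin k))) :
    IsClosed {M : KMarkedGroup k | w ∉ M.relations ⊔ N} := by
  have : {M : KMarkedGroup k | w ∉ M.relations ⊔ N} = ⋂ c ∈ (N : Set (FreeGroup (Fin k))),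
      {M : KMarkedGroup k | w * c⁻¹ ∈ M.relations}ᶜ := by
    ext M
    simp only [Set.mem_ofPred_eq, Set.mem_iInter, Set.mem_compl_iff, SetLike.mem_coe,
      Subgroup.mem_sup_of_normal_left, not_exists, not_and]
    exact ⟨fun h c hc hw => h _ hw c hc (by group), fun h r hr c hc hw => h c hc (by simpa [← hw])⟩
  rw [this]
  exact isClosed_biInter fun c _ => (isClopen_setOf_mem _).compl.isClosed

end KMarkedGroup

/-- The `Π⁰₃` upper bound follows from a countable family of closed conditions that witness
the survival of a given word. -/
theorem isPiZero_residuallySet {C : ∀ (H : Type) [Group H], Prop}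
    (Z : ∀ k, FreeGroup (Fin k) → ℕ → Set (KMarkedGroup k)) (hZ : ∀ k w n, IsClosed (Z k w n))
    (hCZ : ∀ k (M : KMarkedGroup k),
      IsResidually C M.Carrier ↔ ∀ w ∉ M.relations, ∃ n, M ∈ Z k w n) :
    IsPiZero 3 (residuallySet C) := by
  have : residuallySet C = ⋂ p : Σ k, FreeGroup (Fin k), ⋃ n,
      (Sigma.mk p.1 '' ({M | p.2 ∈ M.relations} ∪ Z p.1 p.2 n)ᶜ)ᶜ := by
    ext ⟨k, M⟩
    rw [show ⟨k, M⟩ ∈ residuallySet C ↔ _ from hCZ k M]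
    simp only [Set.mem_iInter, Set.mem_iUnion]
    constructor
    · rintro h ⟨k', w⟩
      by_cases hk : k = k'
      · subst hk
        by_cases hw : w ∈ M.relations
        · refine ⟨0, ?_⟩
          rintro ⟨M', hM', heq⟩
          cases heq
          exact hM' (Or.inl hw)
        · obtain ⟨n, hn⟩ := h w hw
          refine ⟨n, ?_⟩
          rintro ⟨M', hM', heq⟩
          cases heq
          exact hM' (Or.inr hn)
      · refine ⟨0, ?_⟩
        rintro ⟨M', -, heq⟩
        exact hk (congrArg Sigma.fst heq).symm
    · intro h w hw
      obtain ⟨n, hn⟩ := h ⟨k, w⟩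
      refine ⟨n, ?_⟩
      by_contra hM
      exact hn ⟨M, by simp [hw, hM], rfl⟩
  rw [this]
  have : Countable (Σ k, FreeGroup (Fin k)) := inferInstance
  refine isPiZero_three_iInter_iUnion _ fun p n => IsOpen.isClosed_compl ?_
  exact isOpenMap_sigmaMk _
    ((KMarkedGroup.isClopen_setOf_mem p.2).isClosed.union (hZ _ _ n)).isOpen_compl

theorem isPiZero_residuallySet_of_isFinitelyPresented {C : ∀ (H : Type) [Group H], Prop}
    (hC : ∀ (H K : Type) [Group H] [Group K], H ≃* K → C H → C K)
    (hfp : ∀ (H : Type) [Group H], C H → Group.IsFinitelyPresented H) :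
    IsPiZero 3 (residuallySet C) := by
  have hcount : ∀ k, {N : Subgroup (FreeGroup (Fin k)) |
      ∃ _ : N.Normal, C (FreeGroup (Fin k) ⧸ N)}.Countable := fun k => by
    refine (Set.countable_range fun S : Finset (FreeGroup (Fin k)) =>
      Subgroup.normalClosure (S : Set (FreeGroup (Fin k)))).mono ?_
    rintro N ⟨hN, hCN⟩
    obtain ⟨S, hS, hSN⟩ := (hfp _ hCN).isFinitelyNormallyGenerated_of_quotient
    exact ⟨hS.toFinset, by simpa using hSN⟩
  have hne : ∀ k, ∃ E : ℕ → Set (Subgroup (FreeGroup (Fin k))), (∀ n, (E n).Subsingleton) ∧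
      ⋃ n, E n = {N : Subgroup (FreeGroup (Fin k)) | ∃ _ : N.Normal, C (FreeGroup (Fin k) ⧸ N)} := fun k => by
    rcases Set.eq_empty_or_nonempty {N : Subgroup (FreeGroup (Fin k)) |
      ∃ _ : N.Normal, C (FreeGroup (Fin k) ⧸ N)} with h | h
    · exact ⟨fun _ => ∅, by simp [h]⟩
    · obtain ⟨f, hf⟩ := (hcount k).exists_eq_range h
      exact ⟨fun n => {f n}, by simp [hf]⟩
  choose E hE hEC using hne
  refine isPiZero_residuallySet (fun k w n => ⋃ N ∈ {N | N ∈ E k n ∧ w ∉ N},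
    {M | M.relations ≤ N}) (fun k w n => ?_) fun k M => ?_
  · refine Set.Finite.isClosed_biUnion ?_ fun N _ => KMarkedGroup.isClosed_setOf_le N
    exact ((hE k n).anti fun N hN => hN.1).finite
  · rw [isResidually_quotient_iff hC]
    refine forall₂_congr fun w _ => ?_
    have hmem : ∀ N, (∃ n, N ∈ E k n) ↔ ∃ _ : N.Normal, C (FreeGroup (Fin k) ⧸ N) := fun N => by
      rw [← Set.mem_iUnion, hEC]; exact Iff.rfl
    simp only [Set.mem_iUnion, Set.mem_ofPred_eq, exists_prop]
    constructor
    · rintro ⟨N, hN, hMN, hCN, hw⟩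
      obtain ⟨n, hn⟩ := (hmem N).2 ⟨hN, hCN⟩
      exact ⟨n, N, ⟨hn, hw⟩, hMN⟩
    · rintro ⟨n, N, ⟨hn, hw⟩, hMN⟩
      obtain ⟨hN, hCN⟩ := (hmem N).1 ⟨n, hn⟩
      exact ⟨N, hN, hMN, hCN, hw⟩

theorem isPiZero_residuallySet_isNilpotent :
    IsPiZero 3 (residuallySet fun H _ => Group.IsNilpotent H) := by
  refine isPiZero_residuallySet
    (fun k w n => {M | w ∉ M.relations ⊔ (⊤ : Subgroup (FreeGroup (Fin k))).lowerCentralSeries n})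
    (fun k w n => KMarkedGroup.isClosed_setOf_notMem_sup w _) fun k M => ?_
  rw [isResidually_quotient_iff fun H K _ _ e (_ : Group.IsNilpotent H) => Group.nilpotent_of_mulEquiv e]
  refine forall₂_congr fun w _ => ?_
  simp only [isNilpotent_quotient_iff_lowerCentralSeries_le]
  constructor
  · rintro ⟨N, hN, hMN, ⟨n, hn⟩, hw⟩
    exact ⟨n, fun h => hw (sup_le hMN hn h)⟩
  · rintro ⟨n, hn⟩
    exact ⟨_, inferInstance, le_sup_left, ⟨n, le_sup_right⟩, hn⟩

/-! ### Hall's class of groups -/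

/-- The group algebra of `Γ` over the field with two elements. For `Γ = ℤ` it is the ring of Laurent
polynomials `(ZMod 2)[T;T⁻¹]`. -/
abbrev GroupAlgebraTwo (Γ : Type*) : Type _ := AddMonoidAlgebra (ZMod 2) Γ

namespace GroupAlgebraTwo

variable {Γ Γ' : Type*} [AddCommGroup Γ] [AddCommGroup Γ']

/-- The element of the group algebra given by a group element. -/
noncomputable def mono (γ : Γ) : GroupAlgebraTwo Γ := AddMonoidAlgebra.single γ 1

theorem mono_zero : mono (0 : Γ) = 1 := rfl

theorem mono_add (γ δ : Γ) : mono (γ + δ) = mono γ * mono δ := by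
  simp [mono, AddMonoidAlgebra.single_mul_single]

/-- The involution of the group algebra that inverts the group elements. -/
noncomputable def invol : GroupAlgebraTwo Γ →+* GroupAlgebraTwo Γ :=
  (AddMonoidAlgebra.domCongr (ZMod 2) (ZMod 2) (AddEquiv.neg Γ)).toRingEquiv.toRingHom

theorem invol_mono (γ : Γ) : invol (mono γ) = mono (-γ) := by
  simp [invol, mono]

theorem mono_neg_mul (γ : Γ) : mono (-γ) * mono γ = 1 := by
  rw [← mono_add, neg_add_cancel, mono_zero]

/-- The ring homomorphism of group algebras induced by a group homomorphism. -/
noncomputable def map (φ : Γ →+ Γ') : GroupAlgebraTwo Γ →+* GroupAlgebraTwo Γ' :=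
  AddMonoidAlgebra.mapDomainRingHom (ZMod 2) φ

theorem map_mono (φ : Γ →+ Γ') (γ : Γ) : map φ (mono γ) = mono (φ γ) := by
  simp [map, mono]

@[elab_as_elim]
theorem induction_mono {P : GroupAlgebraTwo Γ → Prop} (f : GroupAlgebraTwo Γ) (h0 : P 0)
    (hadd : ∀ f g, P f → P g → P (f + g)) (hmono : ∀ γ, P (mono γ)) : P f := by
  refine AddMonoidAlgebra.induction_linear f h0 (fun f g => hadd f g) fun γ r => ?_
  obtain rfl | rfl : r = 0 ∨ r = 1 := by revert r; decide
  · simpa using h0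
  · exact hmono γ

theorem map_invol (φ : Γ →+ Γ') (f : GroupAlgebraTwo Γ) : map φ (invol f) = invol (map φ f) := by
  induction f using induction_mono with
  | h0 => simp
  | hadd f g hf hg => simp only [map_add, hf, hg]
  | hmono γ => simp only [invol_mono, map_mono, map_neg]

end GroupAlgebraTwo

open GroupAlgebraTwo
open scoped commutatorElement

/-- The group of triples `(f, v, γ)`, with `f` in the group algebra of `Γ`, `v` in `V` and `γ` in
`Γ`, in which `γ` acts on `f` by multiplication and `v` is central; the cocycle of the central
extension is `(f, g) ↦ L (invol f * g)`. For `L = id` this is the group of matrices with rows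
`(1, invol f * γ, v)`, `(0, γ, f)`, `(0, 0, 1)`. -/
@[ext]
structure HallGroup {Γ V : Type*} [AddCommGroup Γ] [AddCommGroup V]
    (L : GroupAlgebraTwo Γ →+ V) where
  /-- the coordinate in the group algebra -/
  base : GroupAlgebraTwo Γ
  /-- the central coordinate -/
  ctr : V
  /-- the coordinate in the group that acts -/
  top : Γ

namespace HallGroup

variable {Γ V Γ' V' : Type*} [AddCommGroup Γ] [AddCommGroup V] [AddCommGroup Γ'] [AddCommGroup V']
variable {L : GroupAlgebraTwo Γ →+ V} {L' : GroupAlgebraTwo Γ' →+ V'}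

noncomputable instance : Mul (HallGroup L) :=
  ⟨fun x y => ⟨x.base + mono x.top * y.base,
    x.ctr + y.ctr + L (invol x.base * (mono x.top * y.base)), x.top + y.top⟩⟩

noncomputable instance : One (HallGroup L) := ⟨⟨0, 0, 0⟩⟩

noncomputable instance : Inv (HallGroup L) :=
  ⟨fun x => ⟨-(mono (-x.top) * x.base), -x.ctr + L (invol x.base * x.base), -x.top⟩⟩

@[simp] theorem base_mul (x y : HallGroup L) : (x * y).base = x.base + mono x.top * y.base := rfl
@[simp] theorem ctr_mul (x y : HallGroup L) :
    (x * y).ctr = x.ctr + y.ctr + L (invol x.base * (mono x.top * y.base)) := rfl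
@[simp] theorem top_mul (x y : HallGroup L) : (x * y).top = x.top + y.top := rfl
@[simp] theorem base_one : (1 : HallGroup L).base = 0 := rfl
@[simp] theorem ctr_one : (1 : HallGroup L).ctr = 0 := rfl
@[simp] theorem top_one : (1 : HallGroup L).top = 0 := rfl
@[simp] theorem base_inv (x : HallGroup L) : x⁻¹.base = -(mono (-x.top) * x.base) := rfl
@[simp] theorem ctr_inv (x : HallGroup L) : x⁻¹.ctr = -x.ctr + L (invol x.base * x.base) := rfl
@[simp] theorem top_inv (x : HallGroup L) : x⁻¹.top = -x.top := rfl

noncomputable instance : Group (HallGroup L) :=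
  Group.ofLeftAxioms
    (fun x y z => by
      ext1
      · simp only [base_mul, top_mul, mono_add]; ring
      · have h : invol (mono x.top * y.base) * (mono (x.top + y.top) * z.base) =
            invol y.base * (mono y.top * z.base) := by
          rw [map_mul, invol_mono, mono_add]
          linear_combination (invol y.base * mono y.top * z.base) * mono_neg_mul x.top
        simp only [ctr_mul, base_mul, top_mul, map_add, add_mul, mul_add, h]
        rw [mono_add, mul_assoc (mono x.top)]
        abel
      · simp only [top_mul]; abel)
    (fun x => by ext1 <;> simp [mono_zero])
    (fun x => by
      ext1
      · simp
      · have h : invol (mono (-x.top) * x.base) * (mono (-x.top) * x.base) = invol x.base * x.base := by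
          rw [map_mul, invol_mono]
          linear_combination (invol x.base * x.base) * mono_neg_mul (-x.top)
        simp only [ctr_mul, ctr_inv, base_inv, top_inv, ctr_one, map_neg, neg_mul, h]
        abel
      · simp)

/-- The functoriality of the construction. -/
noncomputable def map (φ : Γ →+ Γ') (l : V →+ V')
    (h : ∀ f, l (L f) = L' (GroupAlgebraTwo.map φ f)) : HallGroup L →* HallGroup L' :=
  MonoidHom.mk' (fun x => ⟨GroupAlgebraTwo.map φ x.base, l x.ctr, φ x.top⟩) fun x y => by
    ext1 <;> simp [h, map_mono, map_invol]

/-- The homomorphism from the free group onto the subgroup generated by the element `γ` of the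
group that acts and the unit of the group algebra. -/
noncomputable def eval (L : GroupAlgebraTwo Γ →+ V) (γ : Γ) : FreeGroup (Fin 2) →* HallGroup L :=
  FreeGroup.lift ![⟨0, 0, γ⟩, ⟨1, 0, 0⟩]

theorem eval_of_zero (γ : Γ) : eval L γ (FreeGroup.of 0) = ⟨0, 0, γ⟩ := by simp [eval]

theorem eval_of_one (γ : Γ) : eval L γ (FreeGroup.of 1) = ⟨1, 0, 0⟩ := by simp [eval]

theorem map_comp_eval (φ : Γ →+ Γ') (l : V →+ V')
    (h : ∀ f, l (L f) = L' (GroupAlgebraTwo.map φ f)) (γ : Γ) :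
    (map φ l h).comp (eval L γ) = eval L' (φ γ) := by
  refine FreeGroup.ext_hom _ _ fun i => ?_
  fin_cases i <;> simp [eval, map]

/-- The universal evaluation: by `eval_eq`, it determines all others. -/
noncomputable abbrev word : FreeGroup (Fin 2) →* HallGroup (AddMonoidHom.id (GroupAlgebraTwo ℤ)) :=
  eval _ 1

theorem eval_eq (L : GroupAlgebraTwo Γ →+ V) (γ : Γ) (w : FreeGroup (Fin 2)) :
    eval L γ w = ⟨GroupAlgebraTwo.map (zmultiplesHom Γ γ) (word w).base,
      L (GroupAlgebraTwo.map (zmultiplesHom Γ γ) (word w).ctr), (word w).top • γ⟩ := by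
  have := DFunLike.congr_fun (map_comp_eval (L := AddMonoidHom.id (GroupAlgebraTwo ℤ)) (L' := L)
    (zmultiplesHom Γ γ) (L.comp (GroupAlgebraTwo.map (zmultiplesHom Γ γ)).toAddMonoidHom)
    (fun f => rfl) 1) w
  rw [zmultiplesHom_apply, one_zsmul] at this
  exact this.symm

theorem zpow_eq (γ : Γ) (n : ℤ) : (⟨0, 0, γ⟩ : HallGroup L) ^ n = ⟨0, 0, n • γ⟩ := by
  have := map_zpow (MonoidHom.mk' (fun n : Multiplicative Γ => (⟨0, 0, n.toAdd⟩ : HallGroup L))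
    fun a b => by ext1 <;> simp) (Multiplicative.ofAdd γ) n
  exact this.symm

theorem commutator_of_top_eq_zero {x y : HallGroup L} (hx : x.top = 0) (hy : y.top = 0) :
    (⁅x, y⁆ : HallGroup L) = ⟨0, L (invol x.base * y.base) - L (invol y.base * x.base), 0⟩ := by
  rw [commutatorElement_def, mul_assoc, ← mul_inv_rev, mul_inv_eq_iff_eq_mul]
  ext1 <;> simp [hx, hy, mono_zero, add_comm]

theorem conj_top (f : GroupAlgebraTwo Γ) (v : V) (γ : Γ) :
    (⟨0, 0, γ⟩ : HallGroup L) * ⟨f, v, 0⟩ * (⟨0, 0, γ⟩ : HallGroup L)⁻¹ = ⟨mono γ * f, v, 0⟩ := by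
  ext1 <;> simp

/-- The central subgroup of the triples `(0, v, 0)` with `v ∈ W`. -/
def central (L : GroupAlgebraTwo Γ →+ V) (W : AddSubgroup V) : Subgroup (HallGroup L) where
  carrier := {x | x.base = 0 ∧ x.top = 0 ∧ x.ctr ∈ W}
  mul_mem' := by
    rintro x y ⟨hx, hx', hxW⟩ ⟨hy, hy', hyW⟩
    simpa [hx, hx', hy, hy'] using W.add_mem hxW hyW
  one_mem' := by simp
  inv_mem' := by
    rintro x ⟨hx, hx', hxW⟩
    simpa [hx, hx'] using hxW

instance (W : AddSubgroup V) : (central L W).Normal where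
  conj_mem := by
    rintro x ⟨hx, hx', hxW⟩ y
    have : y * x * y⁻¹ = x := by
      rw [mul_inv_eq_iff_eq_mul]
      ext1 <;> simp [hx, hx', mono_zero, add_comm]
    rw [this]
    exact ⟨hx, hx', hxW⟩

end HallGroup

open HallGroup

/-! ### Quotients of Hall's group -/

/-- Modulo a nonzero Laurent polynomial over the field with two elements, the variable has finite
order, as there are only finitely many remainders. -/
theorem GroupAlgebraTwo.exists_dvd_mono_sub_one {f : GroupAlgebraTwo ℤ} (hf : f ≠ 0) :
    ∃ m : ℕ, 0 < m ∧ f ∣ mono (m : ℤ) - 1 := by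
  obtain ⟨n, p, hp⟩ := LaurentPolynomial.exists_T_pow f
  have hp0 : p ≠ 0 := by
    rintro rfl
    rw [map_zero] at hp
    exact hf ((LaurentPolynomial.isUnit_T (R := ZMod 2) n).mul_left_eq_zero.1 hp.symm)
  have : Module.Finite (ZMod 2) (AdjoinRoot p) := (AdjoinRoot.powerBasis hp0).finite
  have : Finite (AdjoinRoot p) := Module.finite_of_finite (ZMod 2)
  obtain ⟨i, j, hij, h⟩ : ∃ i j : ℕ, i < j ∧ AdjoinRoot.root p ^ i = AdjoinRoot.root p ^ j := by
    obtain ⟨i, j, hne, h⟩ := Finite.exists_ne_map_eq_of_infinite fun n : ℕ => AdjoinRoot.root p ^ n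
    rcases hne.lt_or_gt with hlt | hlt
    · exact ⟨i, j, hlt, h⟩
    · exact ⟨j, i, hlt, h.symm⟩
  have hdvd : p ∣ Polynomial.X ^ i * (Polynomial.X ^ (j - i) - 1) := by
    rw [← AdjoinRoot.mk_eq_zero]
    simp [mul_sub, ← pow_add, Nat.add_sub_cancel' hij.le, AdjoinRoot.mk_X, h]
  refine ⟨j - i, by omega, ?_⟩
  have h1 : f ∣ LaurentPolynomial.T i * (LaurentPolynomial.T ((j - i : ℕ) : ℤ) - 1) := by
    have := map_dvd (Polynomial.toLaurent (R := ZMod 2)) hdvd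
    rw [hp] at this
    simpa using (Dvd.intro _ rfl).trans this
  exact ((LaurentPolynomial.isUnit_T (R := ZMod 2) i).dvd_mul_left).1 h1

theorem GroupAlgebraTwo.mono_injective {Γ : Type*} [AddCommGroup Γ] :
    Function.Injective (mono : Γ → GroupAlgebraTwo Γ) := fun a b h => by
  have := congrArg (fun f => AddMonoidAlgebra.coeff f a) h
  by_contra hab
  simp [mono, Ne.symm hab] at this

namespace HallGroup

/-- The commutator of the second generator with its conjugate by a power of the first. -/
def comm (n : ℤ) : FreeGroup (Fin 2) :=
  ⁅FreeGroup.of (1 : Fin 2), FreeGroup.of 0 ^ n * FreeGroup.of 1 * (FreeGroup.of 0 ^ n)⁻¹⁆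

theorem word_conj (n : ℤ) :
    word (FreeGroup.of 0 ^ n * FreeGroup.of 1 * (FreeGroup.of 0 ^ n)⁻¹) = ⟨mono n, 0, 0⟩ := by
  rw [map_mul, map_mul, _root_.map_inv, map_zpow, eval_of_zero, eval_of_one, zpow_eq, conj_top]
  simp

theorem word_comm (n : ℤ) : word (comm n) = ⟨0, mono n - mono (-n), 0⟩ := by
  rw [comm, map_commutatorElement, word_conj, eval_of_one, commutator_of_top_eq_zero rfl rfl]
  simp [invol_mono]

theorem mem_of_word_eq {N : Subgroup (FreeGroup (Fin 2))} (hN : word.ker ≤ N)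
    {w w' : FreeGroup (Fin 2)} (hw : w ∈ N) (h : word w = word w') : w' ∈ N := by
  have : w⁻¹ * w' ∈ N := hN (by rw [MonoidHom.mem_ker, map_mul, _root_.map_inv, h, inv_mul_cancel])
  simpa using N.mul_mem hw this

variable {N : Subgroup (FreeGroup (Fin 2))} [N.Normal]

/-- The coordinates in the group algebra of the elements of `N` with trivial action form an ideal,
as conjugation by the first generator multiplies them by `T`. -/
theorem exists_mem_base_mul {w : FreeGroup (Fin 2)} (hw : w ∈ N) (htop : (word w).top = 0)
    (g : GroupAlgebraTwo ℤ) :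
    ∃ w' ∈ N, (word w').top = 0 ∧ (word w').base = g * (word w).base := by
  induction g using induction_mono with
  | h0 => exact ⟨1, N.one_mem, by simp⟩
  | hadd f g hf hg =>
    obtain ⟨a, ha, ha0, hab⟩ := hf
    obtain ⟨b, hb, hb0, hbb⟩ := hg
    exact ⟨a * b, N.mul_mem ha hb, by simp [ha0, hb0], by
      simp [ha0, hab, hbb, mono_zero, add_mul]⟩
  | hmono n =>
    refine ⟨_, ‹N.Normal›.conj_mem w hw (FreeGroup.of 0 ^ n), ?_⟩
    rw [map_mul, map_mul, _root_.map_inv, map_zpow, eval_of_zero, zpow_eq,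
      show word w = ⟨(word w).base, (word w).ctr, 0⟩ from by ext1 <;> simp [htop], conj_top]
    simp

/-- If some nonzero Laurent polynomial dies in a quotient, then so does `T ^ m - 1` for some
`m > 0`, and the commutators become periodic in the quotient. -/
theorem exists_comm_periodic (hN : word.ker ≤ N)
    (hw : ∃ w ∈ N, (word w).top = 0 ∧ (word w).base ≠ 0) :
    ∃ m : ℕ, 0 < m ∧ ∀ n : ℤ, comm n * (comm (n + m))⁻¹ ∈ N := by
  obtain ⟨w, hw, htop, hbase⟩ := hw
  obtain ⟨m, hm, g, hg⟩ := exists_dvd_mono_sub_one hbase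
  obtain ⟨w', hw', htop', hbase'⟩ := exists_mem_base_mul hw htop g
  rw [mul_comm, ← hg] at hbase'
  -- commuting an element with coordinate `T ^ m - 1` with the conjugate of exponent `n + m`
  -- gives the quotient of two commutators whose indices differ by `m`
  refine ⟨m, hm, fun n => mem_of_word_eq hN (w := ⁅w', FreeGroup.of 0 ^ (n + m) * FreeGroup.of 1 *
    (FreeGroup.of 0 ^ (n + m))⁻¹⁆) ?_ ?_⟩
  · rw [commutatorElement_def, mul_assoc, mul_assoc, ← mul_assoc _ w'⁻¹]
    exact N.mul_mem hw' (‹N.Normal›.conj_mem _ (N.inv_mem hw') _)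
  · rw [map_commutatorElement, word_conj, commutator_of_top_eq_zero htop' rfl, hbase',
      MonoidHom.map_mul,
      _root_.map_inv, word_comm, word_comm]
    ext1
    · simp
    · simp only [AddMonoidHom.id_apply, map_sub, map_one, invol_mono, sub_mul, mul_sub, one_mul,
        mul_one, ← mono_add, ctr_mul, ctr_inv, base_inv, mul_zero, neg_zero, mono_zero,
        map_zero, add_zero]
      rw [show -(m : ℤ) + (n + m) = n by ring, show -(n + (m : ℤ)) + m = -n by ring]
      ring
    · simp

/-- The iterated commutators of the second generator with the first have the coordinates
`(T - 1) ^ n` in the group algebra. -/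
theorem exists_mem_base_ne_zero_of_isNilpotent (h : Group.IsNilpotent (FreeGroup (Fin 2) ⧸ N)) :
    ∃ w ∈ N, (word w).top = 0 ∧ (word w).base ≠ 0 := by
  obtain ⟨n, hn⟩ := (isNilpotent_quotient_iff_lowerCentralSeries_le N).1 h
  suffices ∀ n, ∃ w ∈ (⊤ : Subgroup (FreeGroup (Fin 2))).lowerCentralSeries n,
      (word w).top = 0 ∧ (word w).base ≠ 0 by
    obtain ⟨w, hw, hw'⟩ := this n
    exact ⟨w, hn hw, hw'⟩
  intro n
  induction n with
  | zero => exact ⟨FreeGroup.of 1, trivial, by simp [eval_of_one]⟩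
  | succ n ih =>
    obtain ⟨w, hw, htop, hbase⟩ := ih
    refine ⟨⁅w, FreeGroup.of 0⁆, Subgroup.commutator_mem_commutator hw trivial, ?_⟩
    rw [map_commutatorElement, eval_of_zero, commutatorElement_def]
    have hT : mono (1 : ℤ) ≠ mono 0 := mono_injective.ne one_ne_zero
    have hne : (1 - mono (1 : ℤ)) * (word w).base ≠ 0 :=
      mul_ne_zero (sub_ne_zero.2 hT.symm) hbase
    refine ⟨by simp [htop], ?_⟩
    simpa [htop, mono_zero, sub_mul, ← sub_eq_add_neg] using hne

/-- A finitely presented quotient in which the group algebra embeds is a quotient by central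
elements only, and these involve only finitely many powers of `T`. -/
theorem exists_finset_coeff_ctr_eq_zero (hN : N.IsFinitelyNormallyGenerated)
    (hbase : ∀ w ∈ N, (word w).top = 0 → (word w).base = 0) :
    ∃ E : Finset ℤ, ∀ w ∈ N, ∀ n ∉ E, (word w).ctr.coeff n = 0 := by
  have htop : ∀ w ∈ N, (word w).top = 0 := fun w hw => by
    -- the commutator with the second generator has the coordinate `T ^ top - 1`
    have h := hbase ⁅w, FreeGroup.of 1⁆ (by
      rw [commutatorElement_def, mul_assoc, mul_assoc, ← mul_assoc _ w⁻¹]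
      exact N.mul_mem hw (‹N.Normal›.conj_mem _ (N.inv_mem hw) _))
    rw [map_commutatorElement, eval_of_one, commutatorElement_def] at h
    have h := h (by simp)
    refine mono_injective ?_
    rw [mono_zero, ← sub_eq_zero]
    simp [mono_zero, ← mul_assoc, ← mono_add, ← sub_eq_add_neg] at h
    exact h
  obtain ⟨S, hS, rfl⟩ := hN
  classical
  refine ⟨hS.toFinset.biUnion fun w => (word w).ctr.coeff.support, fun w hw n hn => ?_⟩
  let W : AddSubgroup (GroupAlgebraTwo ℤ) :=
    ((Finsupp.applyAddHom n).comp AddMonoidAlgebra.coeffAddEquiv.toAddMonoidHom).ker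
  have hle : Subgroup.normalClosure S ≤ (central _ W).comap word := by
    refine Subgroup.normalClosure_le_normal fun s hs => ?_
    have hsN := Subgroup.subset_normalClosure hs
    refine ⟨hbase s hsN (htop s hsN), htop s hsN, ?_⟩
    by_contra h
    exact hn (Finset.mem_biUnion.2 ⟨s, by simpa using hs, Finsupp.mem_support_iff.2 h⟩)
  exact (hle hw).2.2

/-- Let infinitely many of the commutators coincide in a group. If their indices have all
natural numbers as divisors, then the common value dies in all quotients that are nilpotent or
finitely presented. -/
theorem comm_mem_of_isNilpotent_or_isFinitelyPresented (hN : word.ker ≤ N)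
    (h : Group.IsNilpotent (FreeGroup (Fin 2) ⧸ N) ∨
      Group.IsFinitelyPresented (FreeGroup (Fin 2) ⧸ N))
    {q₀ : ℕ} (hq₀ : 0 < q₀) {Q : Set ℕ} (hQ : Q.Infinite) (hdvd : ∀ m > 0, ∃ q ∈ Q, m ∣ q)
    (hcomm : ∀ q ∈ Q, comm q₀ * (comm q)⁻¹ ∈ N) : comm q₀ ∈ N := by
  by_cases hw : ∃ w ∈ N, (word w).top = 0 ∧ (word w).base ≠ 0
  · obtain ⟨m, hm, hper⟩ := exists_comm_periodic hN hw
    have hmul : ∀ j : ℕ, comm ((m * j : ℕ) : ℤ) ∈ N := fun j => by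
      induction j with
      | zero => exact hN (by rw [MonoidHom.mem_ker, word_comm]; ext1 <;> simp)
      | succ j ih =>
        have := N.mul_mem (N.inv_mem (hper ((m * j : ℕ) : ℤ))) ih
        rw [mul_inv_rev, inv_inv, inv_mul_cancel_right] at this
        exact_mod_cast this
    obtain ⟨q, hqQ, j, rfl⟩ := hdvd m hm
    simpa using N.mul_mem (hcomm _ hqQ) (hmul j)
  · exfalso
    rcases h with h | h
    · exact hw (exists_mem_base_ne_zero_of_isNilpotent h)
    · push Not at hw
      obtain ⟨E, hE⟩ :=
        exists_finset_coeff_ctr_eq_zero (h.isFinitelyNormallyGenerated_of_quotient N) hw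
      obtain ⟨q, hqQ, hqE⟩ := hQ.exists_notMem_finite
        (((E.finite_toSet.preimage Nat.cast_injective.injOn)).union (Set.finite_le_nat q₀))
      simp only [Set.mem_union, Set.mem_preimage, Finset.mem_coe, Set.mem_ofPred_eq, not_or,
        not_le] at hqE
      have h0 := hE _ (hcomm q hqQ) q hqE.1
      have hctr : (word (comm q₀ * (comm q)⁻¹)).ctr =
          mono (q₀ : ℤ) - mono (-q₀ : ℤ) - (mono (q : ℤ) - mono (-q : ℤ)) := by
        rw [map_mul, _root_.map_inv, word_comm, word_comm]
        simp [sub_eq_add_neg]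
      rw [hctr] at h0
      have h1 : (q₀ : ℤ) ≠ q := by omega
      have h2 : -(q₀ : ℤ) ≠ q := by omega
      have h3 : -(q : ℤ) ≠ q := by omega
      simp [mono, h1, h2, h3] at h0

end HallGroup

/-! ### Identifications of central elements -/

namespace GroupAlgebraTwo

variable {Γ Γ' V : Type*} [AddCommGroup V] [Module (ZMod 2) V]

/-- The additive map on the group algebra with prescribed values on the group elements. -/
noncomputable def functional (b : Γ → V) : GroupAlgebraTwo Γ →+ V :=
  AddMonoidHom.mk' (fun f => Finsupp.linearCombination (ZMod 2) b f.coeff) fun f g => by simp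

theorem functional_apply (b : Γ → V) (f : GroupAlgebraTwo Γ) :
    functional b f = ∑ n ∈ f.coeff.support, f.coeff n • b n := by
  simp [functional, Finsupp.linearCombination_apply, Finsupp.sum]

theorem functional_mono (b : Γ → V) (n : Γ) : functional b (mono n) = b n := by
  simp [functional, mono]

variable [AddCommGroup Γ] [AddCommGroup Γ']

theorem functional_map (b : Γ' → V) (φ : Γ →+ Γ') (f : GroupAlgebraTwo Γ) :
    functional b (map φ f) = functional (b ∘ φ) f := by
  induction f using induction_mono with
  | h0 => simp
  | hadd f g hf hg => simp only [map_add, hf, hg]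
  | hmono γ => simp only [map_mono, functional_mono, Function.comp_apply]

theorem map_id (f : GroupAlgebraTwo Γ) : map (AddMonoidHom.id Γ) f = f := by
  simp [map]

theorem map_ne_zero {f : GroupAlgebraTwo Γ} (hf : f ≠ 0) {φ : Γ →+ Γ'}
    (hφ : Set.InjOn φ f.coeff.support) : map φ f ≠ 0 := by
  intro h
  obtain ⟨n, hn⟩ := Finsupp.support_nonempty_iff.2 (mt AddMonoidAlgebra.coeff_eq_zero.1 hf)
  have h1 : (map φ f).coeff = f.coeff.mapDomain φ := rfl
  have h2 := Finsupp.mapDomain_apply' _ f.coeff subset_rfl hφ hn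
  rw [← h1, h] at h2
  exact Finsupp.mem_support_iff.1 hn h2.symm

end GroupAlgebraTwo

open scoped Nat in
/-- The absolute values of the exponents at which the central elements of Hall's group may be
identified. The factorials make them converge to `0` in the profinite topology of `ℤ`; the powers
of `2` make each of them either small or zero modulo suitable powers of `2`. -/
def position (j : ℕ) : ℕ := (j + 1)! * 2 ^ (j + 1)!

theorem position_pos (j : ℕ) : 0 < position j :=
  Nat.mul_pos (Nat.factorial_pos _) (Nat.two_pow_pos _)

theorem position_strictMono : StrictMono position := by
  refine strictMono_nat_of_lt_succ fun j => ?_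
  have h := (Nat.factorial_lt (Nat.succ_pos j)).2 (Nat.lt_succ_self (j + 1))
  exact Nat.mul_lt_mul'' h (Nat.pow_lt_pow_right one_lt_two h)

theorem dvd_position {m j : ℕ} (hm : 0 < m) (h : m ≤ j) : m ∣ position j :=
  Dvd.dvd.mul_right (Nat.dvd_factorial hm (by omega)) _

/-- Modulo suitable large powers of `2`, each position is either small or zero. With the exponent
`(J + 1)!`, the positions from the `J`-th on are zero and all previous ones are small. -/
theorem exists_two_pow_gap (B : ℕ) :
    ∃ k, B < 2 ^ k ∧ ∀ j, 3 * position j ≤ 2 ^ k ∨ 2 ^ k ∣ position j := by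
  set J := B + 3 with hJ
  refine ⟨(J + 1).factorial, ?_, fun j => ?_⟩
  · have h1 := Nat.self_le_factorial (J + 1)
    have h2 := Nat.lt_two_pow_self (n := (J + 1).factorial)
    omega
  · rcases lt_or_ge j J with hj | hj
    · left
      have h1 : (j + 1).factorial ≤ J.factorial := Nat.factorial_le hj
      have h2 : 2 * (j + 1).factorial + 2 ≤ (J + 1).factorial := by
        have := Nat.self_le_factorial J
        rw [Nat.factorial_succ J]
        nlinarith
      have h3 := (Nat.lt_two_pow_self (n := (j + 1).factorial)).le
      calc 3 * position j ≤ 4 * (2 ^ (j + 1).factorial * 2 ^ (j + 1).factorial) := by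
            unfold position
            have := Nat.mul_le_mul_right (2 ^ (j + 1).factorial) h3
            omega
        _ = 2 ^ (2 * (j + 1).factorial + 2) := by ring
        _ ≤ 2 ^ (J + 1).factorial := Nat.pow_le_pow_right two_pos h2
    · exact Or.inr (Dvd.dvd.mul_left (pow_dvd_pow 2 (Nat.factorial_le (by omega))) _)

/-- The odd map of the integers that sends the `j`-th position to the `ρ j`-th, and fixes
all integers that are not positions up to sign. -/
noncomputable def redirect (ρ : ℕ → ℕ) (n : ℤ) : ℤ :=
  n.sign * (Function.extend position (fun j => position (ρ j)) id n.natAbs : ℕ)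

theorem redirect_neg (ρ : ℕ → ℕ) (n : ℤ) : redirect ρ (-n) = -redirect ρ n := by
  simp [redirect]

theorem redirect_position (ρ : ℕ → ℕ) (j : ℕ) : redirect ρ (position j) = position (ρ j) := by
  rw [redirect, Int.natAbs_natCast, position_strictMono.injective.extend_apply,
    Int.sign_eq_one_of_pos (by exact_mod_cast position_pos j), one_mul]

theorem redirect_of_notMem_range {ρ : ℕ → ℕ} {n : ℤ} (h : ∀ j, position j ≠ n.natAbs) :
    redirect ρ n = n := by
  rw [redirect, Function.extend_apply' _ _ _ (by simpa using h), id, Int.sign_mul_natAbs]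

theorem exists_eq_position_or_redirect_eq (ρ : ℕ → ℕ) (n : ℤ) :
    (∃ j, n = position j ∨ n = -position j) ∨ redirect ρ n = n := by
  by_cases h : ∃ j, position j = n.natAbs
  · obtain ⟨j, hj⟩ := h
    refine Or.inl ⟨j, ?_⟩
    omega
  · exact Or.inr (redirect_of_notMem_range (by simpa using h))

theorem finite_redirect_fiber {ρ : ℕ → ℕ} (hfin : ∀ j, {i | ρ i = j}.Finite) (c : ℤ) :
    {n | redirect ρ n = c}.Finite := by
  have hpos : ∀ d : ℤ, {i | (position (ρ i) : ℤ) = d}.Finite := fun d => by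
    rcases Set.eq_empty_or_nonempty {i | (position (ρ i) : ℤ) = d} with h | ⟨i₀, hi₀⟩
    · exact h ▸ Set.finite_empty
    · refine (hfin (ρ i₀)).subset fun i hi => position_strictMono.injective ?_
      have hi₀ : (position (ρ i₀) : ℤ) = d := hi₀
      have hi : (position (ρ i) : ℤ) = d := hi
      exact_mod_cast hi.trans hi₀.symm
  refine (((Set.finite_singleton c).union ((hpos c).image fun i => (position i : ℤ))).union
    ((hpos (-c)).image fun i => -(position i : ℤ))).subset fun n (hn : redirect ρ n = c) => ?_
  rcases exists_eq_position_or_redirect_eq ρ n with ⟨j, rfl | rfl⟩ | h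
  · exact Or.inl (Or.inr ⟨j, by rw [redirect_position] at hn; exact hn, rfl⟩)
  · refine Or.inr ⟨j, ?_, rfl⟩
    rw [redirect_neg, redirect_position] at hn
    exact neg_eq_iff_eq_neg.1 hn
  · exact Or.inl (Or.inl (h.symm.trans hn))

/-- If the fibers of `ρ` are finite, then the indicator function of a fiber of `redirect ρ` agrees
on large intervals with functions that are constant on the fibers and periodic, the periods
being powers of `2`. -/
theorem exists_periodic {ρ : ℕ → ℕ} (hρ : ∀ j, ρ (ρ j) = ρ j) (hfin : ∀ j, {i | ρ i = j}.Finite)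
    (c : ℤ) (B : ℕ) :
    ∃ k, B < 2 ^ k ∧ ∃ χ : ZMod (2 ^ k) → ZMod 2, χ 0 = 0 ∧
      (∀ n : ℤ, χ (redirect ρ n) = χ n) ∧
      ∀ n : ℤ, n.natAbs ≤ B → χ n = if n ≠ 0 ∧ redirect ρ n = c then 1 else 0 := by
  set K : Set ℤ := {n | n ≠ 0 ∧ redirect ρ n = c} with hKdef
  have hK : K.Finite := (finite_redirect_fiber hfin c).subset fun n hn => hn.2
  obtain ⟨B', hBB', hB'⟩ : ∃ B', B ≤ B' ∧ ∀ n ∈ K, n.natAbs ≤ B' := by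
    obtain ⟨b, hb⟩ := (hK.image Int.natAbs).bddAbove
    exact ⟨max B b, le_max_left _ _, fun n hn => (hb ⟨n, hn, rfl⟩).trans (le_max_right _ _)⟩
  obtain ⟨k, hk, hgap⟩ := exists_two_pow_gap (3 * B')
  have hcast : ∀ a b : ℤ, (a : ZMod (2 ^ k)) = b → (a - b).natAbs < 2 ^ k → a = b := by
    intro a b hab hlt
    have h := (ZMod.intCast_eq_intCast_iff_dvd_sub _ _ _).1 hab.symm
    have := Int.eq_zero_of_abs_lt_dvd h (by rw [Int.abs_eq_natAbs]; exact_mod_cast hlt)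
    omega
  classical
  have hsmall : ∀ n : ℤ, n.natAbs ≤ B' → ((∃ a ∈ K, (a : ZMod (2 ^ k)) = n) ↔ n ∈ K) := by
    refine fun n hn => ⟨?_, fun h => ⟨n, h, rfl⟩⟩
    rintro ⟨a, ha, han⟩
    have := hB' a ha
    rwa [← hcast a n han (by omega)]
  -- a position that is not small vanishes modulo `2 ^ k`, while `K` contains small nonzero
  -- integers only
  have hspecial : ∀ n : ℤ, (∃ j, n = position j ∨ n = -position j) →
      ((∃ a ∈ K, (a : ZMod (2 ^ k)) = n) ↔ n ∈ K) := by
    rintro n ⟨j, hj⟩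
    refine ⟨?_, fun h => ⟨n, h, rfl⟩⟩
    rintro ⟨a, ha, han⟩
    have haB := hB' a ha
    rcases hgap j with h | h
    · rwa [← hcast a n han (by omega)]
    · have hn : (n : ZMod (2 ^ k)) = ((0 : ℤ) : ZMod (2 ^ k)) := by
        have h0 : (position j : ZMod (2 ^ k)) = 0 := (ZMod.natCast_eq_zero_iff _ _).2 h
        rcases hj with rfl | rfl <;> simp [h0]
      exact absurd (hcast a 0 (han.trans hn) (by omega)) ha.1
  refine ⟨k, by omega, fun z => if ∃ a ∈ K, (a : ZMod (2 ^ k)) = z then 1 else 0, ?_, ?_, ?_⟩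
  · have := hsmall 0 (by simp)
    rw [Int.cast_zero] at this
    exact if_neg fun h => (this.1 h).1 rfl
  · intro n
    rcases exists_eq_position_or_redirect_eq ρ n with ⟨j, hj⟩ | h
    · have hj' : ∃ i, redirect ρ n = position i ∨ redirect ρ n = -position i := by
        rcases hj with rfl | rfl
        · exact ⟨ρ j, Or.inl (redirect_position ρ j)⟩
        · exact ⟨ρ j, Or.inr (by rw [redirect_neg, redirect_position])⟩
      have hidem : redirect ρ (redirect ρ n) = redirect ρ n := by
        rcases hj with rfl | rfl <;> simp only [redirect_neg, redirect_position, hρ]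
      have h0 : n ≠ 0 := by have := position_pos j; omega
      have h0' : redirect ρ n ≠ 0 := by
        obtain ⟨i, hi⟩ := hj'
        have := position_pos i; omega
      have : redirect ρ n ∈ K ↔ n ∈ K := by
        simp only [hKdef, Set.mem_ofPred_eq, hidem, h0, h0', ne_eq, not_false_eq_true]
      simp only [hspecial _ hj', hspecial _ ⟨j, hj⟩, this]
    · rw [h]
  · intro n hn
    simp only [hsmall n (hn.trans hBB')]
    exact if_congr Iff.rfl rfl rfl

/-- The additive map whose kernel identifies the central elements of Hall's group as prescribed by
`ρ`; the constant term is killed as well, since `0` is the limit of the positions. -/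
noncomputable def identify (ρ : ℕ → ℕ) : GroupAlgebraTwo ℤ →+ (ℤ →₀ ZMod 2) :=
  functional fun n => if n = 0 then 0 else Finsupp.single (redirect ρ n) 1

/-- The relations of the group obtained from Hall's group by the identifications prescribed by
`ρ`. -/
noncomputable def identifiedHall (ρ : ℕ → ℕ) : KMarkedGroup 2 :=
  ⟨(eval (identify ρ) 1).ker, inferInstance⟩

theorem mem_relations_identifiedHall (ρ : ℕ → ℕ) (w : FreeGroup (Fin 2)) :
    w ∈ (identifiedHall ρ).relations ↔
      (word w).base = 0 ∧ identify ρ (word w).ctr = 0 ∧ (word w).top = 0 := by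
  have hid : zmultiplesHom ℤ (1 : ℤ) = AddMonoidHom.id ℤ := by ext; simp
  rw [identifiedHall, MonoidHom.mem_ker, eval_eq, hid, map_id, map_id, HallGroup.ext_iff]
  simp

theorem continuous_identifiedHall {X : Type*} [TopologicalSpace X] {ρ : X → ℕ → ℕ}
    (hρ : ∀ j, IsLocallyConstant fun x => ρ x j) : Continuous fun x => identifiedHall (ρ x) := by
  refine continuous_induced_rng.2 (continuous_pi fun w => IsLocallyConstant.continuous ?_)
  refine (IsLocallyConstant.iff_eventually_eq _).2 fun x => ?_
  have hred : ∀ n : ℤ, ∀ᶠ y in nhds x, redirect (ρ y) n = redirect (ρ x) n := fun n => by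
    by_cases h : ∃ j, position j = n.natAbs
    · obtain ⟨j, hj⟩ := h
      filter_upwards [(hρ j).eventually_eq x] with y hy
      simp only [redirect, ← hj, position_strictMono.injective.extend_apply, hy]
    · refine Filter.Eventually.of_forall fun y => ?_
      rw [redirect_of_notMem_range (by simpa using h), redirect_of_notMem_range (by simpa using h)]
  filter_upwards [(Filter.eventually_all_finset (word w).ctr.coeff.support).2 fun n _ => hred n]
    with y hy
  have : identify (ρ y) (word w).ctr = identify (ρ x) (word w).ctr := by
    rw [identify, identify, functional_apply, functional_apply]
    exact Finset.sum_congr rfl fun n hn => by rw [hy n hn]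
  simp only [Function.comp_apply, KMarkedGroup.wordProblem, mem_relations_identifiedHall, this]

theorem isPGroup_hallGroup_zmod (k : ℕ) (L : GroupAlgebraTwo (ZMod (2 ^ k)) →+ ZMod 2) :
    Finite (HallGroup L) ∧ IsPGroup 2 (HallGroup L) := by
  have : NeZero (2 ^ k) := ⟨by positivity⟩
  let e : HallGroup L ≃ (ZMod (2 ^ k) → ZMod 2) × ZMod 2 × ZMod (2 ^ k) :=
    Equiv.trans ⟨fun x => (x.base, x.ctr, x.top), fun x => ⟨x.1, x.2.1, x.2.2⟩, fun _ => rfl,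
      fun _ => rfl⟩ (Equiv.prodCongr (AddMonoidAlgebra.coeffEquiv.trans Finsupp.equivFunOnFinite)
        (Equiv.refl _))
  refine ⟨Finite.of_equiv _ e.symm, IsPGroup.of_card (n := 2 ^ k + (1 + k)) ?_⟩
  rw [Nat.card_congr e]
  simp [pow_add]

/-- If the identifications are finite-to-one, then the group is residually a finite `2`-group. -/
theorem exists_finite_two_group_of_finite_fibers {ρ : ℕ → ℕ} (hρ : ∀ j, ρ (ρ j) = ρ j)
    (hfin : ∀ j, {i | ρ i = j}.Finite) {w : FreeGroup (Fin 2)}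
    (hw : w ∉ (identifiedHall ρ).relations) :
    ∃ (H : Type) (_ : Group H) (φ : FreeGroup (Fin 2) →* H), Finite H ∧ IsPGroup 2 H ∧
      (identifiedHall ρ).relations ≤ φ.ker ∧ w ∉ φ.ker := by
  set f := (word w).base with hf
  set v := (word w).ctr with hv
  set n := (word w).top with hn
  obtain ⟨c, hc⟩ : ∃ c, identify ρ v ≠ 0 → identify ρ v c ≠ 0 := by
    by_cases h : identify ρ v = 0
    · exact ⟨0, fun h' => absurd h h'⟩
    · obtain ⟨c, hc⟩ := Finsupp.ne_iff.1 h
      exact ⟨c, fun _ => hc⟩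
  -- all exponents that occur in the word are bounded by `B`, hence distinct modulo the period
  obtain ⟨B, hB⟩ : ∃ B, ∀ a ∈ insert n (f.coeff.support ∪ v.coeff.support), a.natAbs ≤ B := by
    obtain ⟨b, hb⟩ := ((insert n (f.coeff.support ∪ v.coeff.support)).finite_toSet.image
      Int.natAbs).bddAbove
    exact ⟨b, fun a ha => hb ⟨a, ha, rfl⟩⟩
  obtain ⟨k, hk, χ, hχ0, hχρ, hχ⟩ := exists_periodic hρ hfin c (2 * B)
  have hcast : ∀ a b : ℤ, a.natAbs ≤ B → b.natAbs ≤ B → (a : ZMod (2 ^ k)) = b → a = b := by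
    intro a b ha hb hab
    have h := (ZMod.intCast_eq_intCast_iff_dvd_sub _ _ _).1 hab.symm
    have h1 : (a - b).natAbs < 2 ^ k := by omega
    have := Int.eq_zero_of_abs_lt_dvd h (by rw [Int.abs_eq_natAbs]; exact_mod_cast h1)
    omega
  let φ : ℤ →+ ZMod (2 ^ k) := Int.castAddHom _
  let l : (ℤ →₀ ZMod 2) →+ ZMod 2 :=
    (Finsupp.linearCombination (ZMod 2) fun a : ℤ => χ a).toAddMonoidHom
  have hl : ∀ g, l (identify ρ g) = functional χ (GroupAlgebraTwo.map φ g) := fun g => by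
    induction g using induction_mono with
    | h0 => simp
    | hadd f g hf hg => simp only [map_add, hf, hg]
    | hmono a =>
      rw [map_mono, identify, functional_mono, functional_mono]
      by_cases ha : a = 0
      · simp [ha, hχ0]
      · simp [ha, l, φ, hχρ]
  have hcomp := map_comp_eval φ l hl 1
  refine ⟨_, inferInstance, eval (functional χ) (φ 1), (isPGroup_hallGroup_zmod _ _).1,
    (isPGroup_hallGroup_zmod _ _).2, fun r hr => ?_, fun hker => hw ?_⟩
  · rw [MonoidHom.mem_ker, ← hcomp, MonoidHom.comp_apply, MonoidHom.mem_ker.1 hr, map_one]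
  · have hφ : zmultiplesHom _ (φ 1) = φ := by ext; simp
    rw [MonoidHom.mem_ker, eval_eq, hφ, HallGroup.ext_iff] at hker
    obtain ⟨h1, h2, h3⟩ := hker
    refine (mem_relations_identifiedHall ρ w).2 ⟨?_, ?_, ?_⟩
    · by_contra h
      refine map_ne_zero h (fun a ha b hb hab => ?_) h1
      exact hcast a b (hB a (by simp_all)) (hB b (by simp_all)) hab
    · by_contra h
      refine hc h ?_
      have h2 : functional χ (GroupAlgebraTwo.map φ v) = 0 := h2
      rw [functional_map, functional_apply] at h2
      rw [identify, functional_apply, Finsupp.finsetSum_apply, ← h2]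
      refine Finset.sum_congr rfl fun a ha => ?_
      have haB := hB a (by simp [ha])
      have : χ (φ a) = _ := hχ a (by omega)
      rw [Function.comp_apply, this]
      by_cases ha0 : a = 0 <;> simp [ha0, Finsupp.single_apply]
    · refine hcast n 0 (hB n (by simp)) (by simp) ?_
      simpa [φ] using h3

theorem isResidually_identifiedHall {C : ∀ (H : Type) [Group H], Prop}
    (hC : ∀ (H K : Type) [Group H] [Group K], H ≃* K → C H → C K)
    (hC2 : ∀ (H : Type) [Group H], Finite H → IsPGroup 2 H → C H)
    {ρ : ℕ → ℕ} (hρ : ∀ j, ρ (ρ j) = ρ j) (hfin : ∀ j, {i | ρ i = j}.Finite) :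
    IsResidually C (identifiedHall ρ).Carrier := by
  rw [isResidually_quotient_iff hC]
  intro w hw
  obtain ⟨H, _, φ, hH, hH2, hle, hwφ⟩ := exists_finite_two_group_of_finite_fibers hρ hfin hw
  exact ⟨φ.ker, inferInstance, hle,
    hC _ _ (QuotientGroup.quotientKerEquivRange φ).symm (hC2 _ inferInstance (hH2.to_subgroup _)),
    hwφ⟩

theorem not_isResidually_identifiedHall {C : ∀ (H : Type) [Group H], Prop}
    (hC : ∀ (H K : Type) [Group H] [Group K], H ≃* K → C H → C K)
    (hCn : ∀ (H : Type) [Group H], C H → Group.IsNilpotent H ∨ Group.IsFinitelyPresented H)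
    {ρ : ℕ → ℕ} {j : ℕ} (hj : ρ j = j) (hinf : {i | ρ i = j}.Infinite) :
    ¬ IsResidually C (identifiedHall ρ).Carrier := by
  rw [isResidually_quotient_iff hC]
  intro h
  have hpos : ∀ i, (position i : ℤ) ≠ 0 := fun i => by exact_mod_cast (position_pos i).ne'
  have hval : ∀ i, identify ρ (mono (position i : ℤ) - mono (-position i : ℤ)) =
      Finsupp.single (position (ρ i) : ℤ) 1 - Finsupp.single (-position (ρ i) : ℤ) 1 := fun i => by
    rw [identify, map_sub, functional_mono, functional_mono, if_neg (hpos i),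
      if_neg (neg_ne_zero.2 (hpos i)), redirect_neg, redirect_position]
  have hnot : comm (position j) ∉ (identifiedHall ρ).relations := fun hmem => by
    have h0 := ((mem_relations_identifiedHall ρ _).1 hmem).2.1
    rw [word_comm, hval, hj, sub_eq_zero] at h0
    have := (Finsupp.single_left_inj (one_ne_zero)).1 h0
    have := hpos j
    omega
  obtain ⟨N, hN, hle, hCN, hw⟩ := h _ hnot
  refine hw (comm_mem_of_isNilpotent_or_isFinitelyPresented (fun w hw => hle ?_) (hCn _ hCN)
    (position_pos j) (hinf.image position_strictMono.injective.injOn) (fun m hm => ?_) ?_)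
  · rw [mem_relations_identifiedHall, MonoidHom.mem_ker.1 hw]
    simp
  · obtain ⟨i, hi, hmi⟩ := hinf.exists_gt m
    exact ⟨_, ⟨i, hi, rfl⟩, dvd_position hm hmi.le⟩
  · rintro _ ⟨i, hi, rfl⟩
    refine hle ((mem_relations_identifiedHall ρ _).2 ?_)
    rw [map_mul, map_inv, word_comm, word_comm]
    have hi : ρ i = j := hi
    have h1 := hval j
    have h2 := hval i
    rw [hj] at h1
    rw [hi] at h2
    refine ⟨by simp, ?_, by simp⟩
    simp only [ctr_mul, ctr_inv, base_inv, mul_zero, neg_zero, map_zero, add_zero]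
    rw [map_add, map_neg, h1, h2, add_neg_cancel]

/-! ### Completeness -/

open Classical in
/-- The identifications prescribed by a sequence of sets of naturals: the code of `(i, l + 1)` is
identified with that of `(i, 0)` if `l` lies in the `i`-th set. -/
noncomputable def identification (S : ℕ → Set ℕ) (n : ℕ) : ℕ :=
  if n.unpair.2 ≠ 0 ∧ n.unpair.2 - 1 ∈ S n.unpair.1 then Nat.pair n.unpair.1 0 else n

theorem identification_pair_zero (S : ℕ → Set ℕ) (i : ℕ) :
    identification S (Nat.pair i 0) = Nat.pair i 0 := by
  simp [identification]

theorem identification_identification (S : ℕ → Set ℕ) (n : ℕ) :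
    identification S (identification S n) = identification S n := by
  by_cases h : n.unpair.2 ≠ 0 ∧ n.unpair.2 - 1 ∈ S n.unpair.1
  · rw [identification, identification, if_pos h, ← identification, identification_pair_zero]
  · have : identification S n = n := if_neg h
    rw [this, this]

theorem finite_identification_fiber {S : ℕ → Set ℕ} (hS : ∀ i, (S i).Finite) (j : ℕ) :
    {n | identification S n = j}.Finite := by
  refine ((Set.finite_singleton j).union
    ((hS j.unpair.1).image fun l => Nat.pair j.unpair.1 (l + 1))).subset fun n hn => ?_
  have hn : identification S n = j := hn
  rw [identification] at hn
  split_ifs at hn with h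
  · subst hn
    refine Or.inr ⟨n.unpair.2 - 1, by simpa using h.2, ?_⟩
    simp only [Nat.unpair_pair]
    rw [Nat.sub_add_cancel (Nat.one_le_iff_ne_zero.2 h.1), Nat.pair_unpair]
  · exact Or.inl hn

theorem infinite_identification_fiber {S : ℕ → Set ℕ} {i : ℕ} (hS : (S i).Infinite) :
    {n | identification S n = Nat.pair i 0}.Infinite := by
  refine (hS.image (f := fun l => Nat.pair i (l + 1)) fun a _ b _ h => ?_).mono ?_
  · simpa using (Nat.pair_eq_pair.1 h).2
  · rintro _ ⟨l, hl, rfl⟩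
    simp [identification, hl]

theorem isLocallyConstant_identification {X : Type*} [TopologicalSpace X] {S : ℕ → X → Set ℕ}
    (hS : ∀ i n, IsClopen {x | n ∈ S i x}) (j : ℕ) :
    IsLocallyConstant fun x => identification (fun i => S i x) j := by
  have h : IsLocallyConstant fun x => j.unpair.2 - 1 ∈ S j.unpair.1 x := by
    refine (IsLocallyConstant.iff_eventually_eq _).2 fun x => ?_
    by_cases hx : j.unpair.2 - 1 ∈ S j.unpair.1 x
    · filter_upwards [(hS j.unpair.1 (j.unpair.2 - 1)).isOpen.mem_nhds hx] with y hy
      exact propext ⟨fun _ => hx, fun _ => hy⟩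
    · filter_upwards [(hS j.unpair.1 (j.unpair.2 - 1)).compl.isOpen.mem_nhds hx] with y hy
      exact propext ⟨fun h => absurd h hy, fun h => absurd h hx⟩
  classical
  exact h.comp fun p : Prop => if j.unpair.2 ≠ 0 ∧ p then Nat.pair j.unpair.1 0 else j

/-- Hardness for all classes that contain the finite `2`-groups and only nilpotent or finitely
presented groups. -/
theorem wadgeReducible_residuallySet {C : ∀ (H : Type) [Group H], Prop}
    (hC : ∀ (H K : Type) [Group H] [Group K], H ≃* K → C H → C K)
    (hC2 : ∀ (H : Type) [Group H], Finite H → IsPGroup 2 H → C H)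
    (hCn : ∀ (H : Type) [Group H], C H → Group.IsNilpotent H ∨ Group.IsFinitelyPresented H)
    {X : Type*} [TopologicalSpace X] [SecondCountableTopology X]
    (hX : TopologicalSpace.IsTopologicalBasis {U : Set X | IsClopen U}) {B : Set X}
    (hB : IsPiZero 3 B) : WadgeReducible B (residuallySet C) := by
  obtain ⟨S, hS, hBS⟩ := hB.exists_finite_iff hX
  refine ⟨fun x => ⟨2, identifiedHall (identification fun i => S i x)⟩,
    continuous_sigmaMk.comp (continuous_identifiedHall fun j =>
      isLocallyConstant_identification hS j), Set.ext fun x => ?_⟩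
  rw [hBS]
  constructor
  · intro hx i
    by_contra hinf
    have hinf : (S i x).Infinite := hinf
    exact not_isResidually_identifiedHall hC hCn (identification_pair_zero _ i)
      (infinite_identification_fiber hinf) hx
  · intro hx
    exact isResidually_identifiedHall hC hC2 (identification_identification _)
      (finite_identification_fiber hx)

theorem theoremG :
    IsPiZeroComplete.{u} 3 (residuallySet fun H _ => Finite H) ∧
    IsPiZeroComplete.{u} 3 (residuallySet fun H _ => Group.IsNilpotent H) ∧
    IsPiZeroComplete.{u} 3 (residuallySet fun H _ => Group.IsFinitelyPresented H) := by
  have hfin : ∀ (H K : Type) [Group H] [Group K], H ≃* K → Finite H → Finite K :=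
    fun H K _ _ e _ => Finite.of_equiv H e.toEquiv
  have hnil : ∀ (H K : Type) [Group H] [Group K], H ≃* K →
      Group.IsNilpotent H → Group.IsNilpotent K := fun H K _ _ e _ => Group.nilpotent_of_mulEquiv e
  have hfp : ∀ (H K : Type) [Group H] [Group K], H ≃* K →
      Group.IsFinitelyPresented H → Group.IsFinitelyPresented K :=
    fun H K _ _ e _ => Group.IsFinitelyPresented.equiv e
  have hfinfp : ∀ (H : Type) [Group H], Finite H → Group.IsFinitelyPresented H :=
    fun H _ _ => Group.IsFinitelyPresented.instOfFinite H
  refine ⟨⟨?_, fun X _ _ hX B hB => ?_⟩, ⟨?_, fun X _ _ hX B hB => ?_⟩,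
    ⟨?_, fun X _ _ hX B hB => ?_⟩⟩
  · exact isPiZero_residuallySet_of_isFinitelyPresented hfin hfinfp
  · exact wadgeReducible_residuallySet hfin (fun H _ h _ => h)
      (fun H _ h => Or.inr (hfinfp H h)) hX hB
  · exact isPiZero_residuallySet_isNilpotent
  · exact wadgeReducible_residuallySet hnil (fun H _ _ h => h.isNilpotent)
      (fun H _ h => Or.inl h) hX hB
  · exact isPiZero_residuallySet_of_isFinitelyPresented hfp fun H _ h => h
  · exact wadgeReducible_residuallySet hfp (fun H _ h _ => hfinfp H h)
      (fun H _ h => Or.inr h) hX hB
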